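/- Let $n\ge 0$ and $k\ge 1$ be integers and let $f:\mathbb{R}^n\to\mathbb{R}^k$ be continuous. Then $f$ is affine linear on $\mathbb{R}^n$ if and only if the complement $\Gamma(f)^c=\mathbb{R}^{n+k}\setminus\Gamma(f)$ of its graph $\Gamma(f)=\{(x,f(x)) : x\in\mathbb{R}^n\}$ is a real $(k-1)$-convex set in $\mathbb{R}^{n+k}$. Here, for an integer $q\ge 0$ and an open set $\omega\subset\mathbb{R}^N$, an upper semicontinuous function $u:\omega\to[-\infty,+\infty)$ is called real $q$-convex on $\omega$ if for every $(q+1)$-dimensional real affine subspace $\pi\subset\mathbb{R}^N$, every open Euclidean ball $B$ with $\overline{B}\subset\omega$ and every affine linear function $l:\pi\to\mathbb{R}$ with $u\le l$ on $\partial B\cap\pi$, one has $u\le l$ on $\overline{B}\cap\pi$. (In particular, if $q\ge N$, every upper semicontinuous function is real $q$-convex.) A set $\omega\subset\mathbb{R}^N$ is called a real $q$-convex set if it is open and the function $x\mapsto-\ln d_2(x,\partial\omega)$ is real $q$-convex on $\omega$, where $d_2(x,\partial\omega)=\inf\{\|x-y\|_2 : y\in\partial\omega\}$ is the Euclidean distance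 to the boundary, with $d_2(x,\partial\omega)=+\infty$ and $-\ln d_2(x,\partial\omega)=-\infty$ if $\partial\omega=\emptyset$. -/

import Mathlib

/-- `u : ω → [-∞, +∞)` is real `q`-convex on the open set `ω`: it is upper semicontinuous and has
the local maximum property with respect to affine linear functions on `(q+1)`-dimensional affine
subspaces `π`, tested on the balls whose closure is contained in `ω`.
Only the values of `u` on `ω` matter. Affine linear functions on `π` are given as restrictions of
affine linear functions on the whole space. If `q ≥ dim E`, there is no such `π`, so every upper
semicontinuous function is real `q`-convex. -/
def RealQConvexOn {E : Type*} [NormedAddCommGroup E] [InnerProductSpace ℝ E]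
    (q : ℕ) (u : E → EReal) (ω : Set E) : Prop :=
  (∀ x ∈ ω, u x < ⊤) ∧
  UpperSemicontinuousOn u ω ∧
  ∀ π : AffineSubspace ℝ E, Module.finrank ℝ π.direction = q + 1 →
    ∀ (p : E) (r : ℝ), 0 < r → Metric.closedBall p r ⊆ ω →
      ∀ l : E →ᵃ[ℝ] ℝ,
        (∀ x ∈ Metric.sphere p r ∩ (π : Set E), u x ≤ ((l x : ℝ) : EReal)) →
        ∀ x ∈ Metric.closedBall p r ∩ (π : Set E), u x ≤ ((l x : ℝ) : EReal)

/-- The function `x ↦ -ln d(x, ∂ω)`, with values in `[-∞, +∞]`.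
If `∂ω` is empty, then `d(x, ∂ω) = +∞` and the value is `-∞`. -/
noncomputable def negLogBoundaryDist {E : Type*} [NormedAddCommGroup E] [InnerProductSpace ℝ E]
    (ω : Set E) (x : E) : EReal :=
  -ENNReal.log (Metric.infEDist x (frontier ω))

/-- A set `ω` is a real `q`-convex set: it is open and `x ↦ -ln d(x, ∂ω)` is real `q`-convex
on `ω`. -/
def IsRealQConvexSet {E : Type*} [NormedAddCommGroup E] [InnerProductSpace ℝ E]
    (q : ℕ) (ω : Set E) : Prop :=
  IsOpen ω ∧ RealQConvexOn q (negLogBoundaryDist ω) ω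

/-- The graph `{(x, f x) : x ∈ ℝⁿ}` of `f : ℝⁿ → ℝᵏ` as a subset of `ℝⁿ⁺ᵏ`. -/
def euclideanGraph {n k : ℕ} (f : EuclideanSpace ℝ (Fin n) → EuclideanSpace ℝ (Fin k)) :
    Set (EuclideanSpace ℝ (Fin (n + k))) :=
  {z | ∃ x : EuclideanSpace ℝ (Fin n), z = WithLp.toLp 2 (Fin.append (⇑x) (⇑(f x)))}

/-! If `f` is affine, its graph is an affine subspace `A` of codimension `k`. A `k`-dimensional `π`
either shares a direction with `A` or meets `A` in a point. So through each `x ∈ π` off `A` runs a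
line in `π` along which the distance to `A` is at most `1 + σ * t` times its value at `x`, with `σ`
0 or 1. Since `log (1 + σ * t) ≤ σ * t`, an affine bound for `-log dist` at the two ends of a chord
passes to `x` (`AffineSubspace.isRealQConvexSet_compl`).

Conversely, a continuous midpoint-preserving map is affine. If the midpoint identity fails with
defect `w`, look over the segment at the `k`-dimensional slices `⟪w, y⟫ = m`, with `y` measured from
the chord. Those with `m > M` miss the graph, while the slice `m = M` touches it. Near the edges of
a fixed box the slices stay a uniform distance away, and the maximum principle
`le_of_forall_le_of_affine_max_property` carries this bound inside; letting `m → M` gives a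
contradiction. -/

open Metric Set Filter Topology

/-! ### Real-valued reformulation and the maximum principle on compact sets. -/

section NegLogDistance

variable {G : Type*} [NormedAddCommGroup G] [InnerProductSpace ℝ G]

lemma negLogBoundaryDist_compl_eq {Γ : Set G} (hc : IsClosed Γ) (hne : Γ.Nonempty)
    (hint : interior Γ = ∅) {x : G} (hx : x ∉ Γ) :
    negLogBoundaryDist Γᶜ x = ((-Real.log (infDist x Γ) : ℝ) : EReal) := by
  have hfr : frontier Γᶜ = Γ := by
    rw [frontier_compl, hc.frontier_eq, hint, sdiff_empty]
  have hpos : 0 < (infEDist x Γ).toReal := (hc.notMem_iff_infDist_pos hne).1 hx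
  rw [negLogBoundaryDist, hfr, ENNReal.log_pos_real' hpos, EReal.coe_neg, infDist]

/-- Real `q`-convexity of the complement of a closed nowhere dense set, in terms of real-valued
distances. -/
lemma isRealQConvexSet_compl_iff {q : ℕ} {Γ : Set G} (hc : IsClosed Γ) (hne : Γ.Nonempty)
    (hint : interior Γ = ∅) :
    IsRealQConvexSet q Γᶜ ↔
      ∀ π : AffineSubspace ℝ G, Module.finrank ℝ π.direction = q + 1 →
        ∀ (p : G) (r : ℝ), 0 < r → closedBall p r ⊆ Γᶜ → ∀ l : G →ᵃ[ℝ] ℝ,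
          (∀ x ∈ sphere p r ∩ (π : Set G), -Real.log (infDist x Γ) ≤ l x) →
          ∀ x ∈ closedBall p r ∩ (π : Set G), -Real.log (infDist x Γ) ≤ l x := by
  have key : ∀ x ∈ Γᶜ, negLogBoundaryDist Γᶜ x = ((-Real.log (infDist x Γ) : ℝ) : EReal) :=
    fun x hx => negLogBoundaryDist_compl_eq hc hne hint hx
  constructor
  · rintro ⟨-, -, -, h⟩ π hπ p r hr hb l hl x hx
    have h1 := h π hπ p r hr hb l (fun y hy => by
      rw [key y (hb (sphere_subset_closedBall hy.1))]
      exact EReal.coe_le_coe_iff.2 (hl y hy)) x hx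
    rw [key x (hb hx.1)] at h1
    exact EReal.coe_le_coe_iff.1 h1
  · intro h
    refine ⟨hc.isOpen_compl, fun x hx => ?_, ?_, fun π hπ p r hr hb l hl x hx => ?_⟩
    · rw [key x hx]; exact EReal.coe_lt_top _
    · have : Continuous (negLogBoundaryDist Γᶜ) :=
        continuous_neg.comp (ENNReal.continuous_log.comp continuous_infEDist)
      exact this.upperSemicontinuous.upperSemicontinuousOn _
    · rw [key x (hb hx.1)]
      refine EReal.coe_le_coe_iff.2 (h π hπ p r hr hb l (fun y hy => ?_) x hx)
      have h1 := hl y hy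
      rw [key y (hb (sphere_subset_closedBall hy.1))] at h1
      exact EReal.coe_le_coe_iff.1 h1

/-- A function satisfying the maximum property with respect to affine functions on balls satisfies
the maximum principle on compact subsets of affine subspaces. -/
lemma le_of_forall_le_of_affine_max_property {ω : Set G} (hω : IsOpen ω) {v : G → ℝ}
    (hv : ContinuousOn v ω) {π : AffineSubspace ℝ G}
    (hmax : ∀ (p : G) (r : ℝ), 0 < r → closedBall p r ⊆ ω → ∀ l : G →ᵃ[ℝ] ℝ,
      (∀ x ∈ sphere p r ∩ (π : Set G), v x ≤ l x) →
      ∀ x ∈ closedBall p r ∩ (π : Set G), v x ≤ l x)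
    {K V : Set G} (hK : IsCompact K) (hKω : K ⊆ ω) (hKπ : K ⊆ π) (hV : IsOpen V)
    (hVK : V ∩ π ⊆ K) {c : ℝ} (hc : ∀ x ∈ K \ V, v x ≤ c) : ∀ x ∈ K, v x ≤ c := by
  intro x₁ hx₁
  by_contra! hlt
  obtain ⟨C, hC⟩ := hK.isBounded.exists_norm_le
  -- Two points of `K` are at most `C + C` apart, so adding `ε * ‖x - x₁‖ ^ 2` cannot move the
  -- maximum into `K \ V`.
  obtain ⟨ε, hε, hεC⟩ : ∃ ε > 0, ε * ((C + C) ^ 2 + 1) < v x₁ - c := by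
    have hD : 0 < (C + C) ^ 2 + 1 := by positivity
    refine ⟨(v x₁ - c) / ((C + C) ^ 2 + 1) / 2, by
      have := sub_pos.2 hlt; positivity, ?_⟩
    have := sub_pos.2 hlt
    field_simp
    linarith
  obtain ⟨x₀, hx₀, hmx⟩ := hK.exists_isMaxOn ⟨x₁, hx₁⟩
    (f := fun x => v x + ε * ‖x - x₁‖ ^ 2) (by
      refine (hv.mono hKω).add ?_
      fun_prop)
  have hle : ∀ x ∈ K, v x + ε * ‖x - x₁‖ ^ 2 ≤ v x₀ + ε * ‖x₀ - x₁‖ ^ 2 := fun x hx => hmx hx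
  have hx₀V : x₀ ∈ V := by
    by_contra hn
    have h1 := hc x₀ ⟨hx₀, hn⟩
    have h2 := hle x₁ hx₁
    have h3 : ‖x₀ - x₁‖ ≤ C + C := (norm_sub_le _ _).trans (add_le_add (hC _ hx₀) (hC _ hx₁))
    have h4 : ‖x₀ - x₁‖ ^ 2 ≤ (C + C) ^ 2 := by gcongr
    have h5 : ε * ‖x₀ - x₁‖ ^ 2 ≤ ε * ((C + C) ^ 2 + 1) := by gcongr; linarith
    simp at h2
    linarith
  obtain ⟨r, hr, hrs⟩ := Metric.nhds_basis_closedBall.mem_iff.1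
    ((hV.inter hω).mem_nhds ⟨hx₀V, hKω hx₀⟩)
  -- On the sphere this equals `v x₀ + ε * ‖x₀ - x₁‖ ^ 2 - ε * ‖x - x₁‖ ^ 2`, which bounds `v` by
  -- maximality; at the centre it is `ε * r ^ 2` below `v x₀`.
  let l : G →ᵃ[ℝ] ℝ :=
    (((-2 * ε) • (innerSL ℝ (x₀ - x₁)).toLinearMap).toAffineMap).comp
      (AffineMap.id ℝ G - AffineMap.const ℝ G x₀) + AffineMap.const ℝ G (v x₀ - ε * r ^ 2)
  have hl : ∀ x, l x = -2 * ε * inner ℝ (x₀ - x₁) (x - x₀) + (v x₀ - ε * r ^ 2) := by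
    intro x; simp [l, inner_sub_left]
  have h := hmax x₀ r hr (fun x hx => (hrs hx).2) l (fun x hx => ?_) x₀
    ⟨mem_closedBall_self hr.le, hKπ hx₀⟩
  · rw [hl] at h
    simp only [sub_self, inner_zero_right, mul_zero, zero_add] at h
    have : 0 < ε * r ^ 2 := by positivity
    linarith
  · have h1 := hle x (hVK ⟨(hrs (sphere_subset_closedBall hx.1)).1, hx.2⟩)
    have h2 : ‖x - x₁‖ ^ 2 = ‖x₀ - x₁‖ ^ 2 + 2 * inner ℝ (x₀ - x₁) (x - x₀) + r ^ 2 := by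
      have h3 : x - x₁ = (x₀ - x₁) + (x - x₀) := by abel
      rw [h3, norm_add_sq_real, ← mem_sphere_iff_norm.1 hx.1]
    rw [h2] at h1
    rw [hl]
    linarith

end NegLogDistance

/-! ### Complements of affine subspaces. -/

section AffineSubspaceComplement

variable {G : Type*} [NormedAddCommGroup G] [InnerProductSpace ℝ G]

lemma exists_pos_add_smul_mem_sphere {p x v : G} {r : ℝ} (hx : x ∈ ball p r) (hv : v ≠ 0) :
    ∃ t : ℝ, 0 < t ∧ x + t • v ∈ sphere p r := by
  have hv' : 0 < ‖v‖ := norm_pos_iff.2 hv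
  have hxr : ‖x - p‖ < r := mem_ball_iff_norm.1 hx
  have hr : 0 < r := (norm_nonneg _).trans_lt hxr
  let T : ℝ := (r + r) / ‖v‖
  have hT : 0 ≤ T := by positivity
  have hcont : ContinuousOn (fun t : ℝ => ‖x + t • v - p‖) (Icc 0 T) := by fun_prop
  have hend : r ≤ ‖x + T • v - p‖ := by
    have h1 : T • v = (x + T • v - p) - (x - p) := by abel
    have h2 : ‖T • v‖ = r + r := by
      rw [norm_smul, Real.norm_of_nonneg hT, div_mul_cancel₀ _ hv'.ne']
    have h3 := norm_sub_le (x + T • v - p) (x - p)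
    rw [← h1, h2] at h3
    linarith
  obtain ⟨t, ht, htr⟩ := intermediate_value_Icc hT hcont ⟨by simpa using hxr.le, hend⟩
  refine ⟨t, lt_of_le_of_ne ht.1 ?_, mem_sphere_iff_norm.2 htr⟩
  rintro rfl
  simp at htr
  linarith

/-- In every direction space of complementary dimension there is a direction along which the
distance to an affine subspace is constant or linear. -/
lemma AffineSubspace.exists_direction_infDist_le [FiniteDimensional ℝ G]
    {A π : AffineSubspace ℝ G} (hA : (A : Set G).Nonempty)
    (hfin : Module.finrank ℝ G ≤ Module.finrank ℝ A.direction + Module.finrank ℝ π.direction)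
    {x : G} (hx : x ∈ π) (hxA : x ∉ A) :
    ∃ v ∈ π.direction, v ≠ 0 ∧ ∃ σ : ℝ, 0 ≤ σ ∧ σ ≤ 1 ∧ ∀ t : ℝ, 0 ≤ 1 + σ * t →
      infDist (x + t • v) A ≤ (1 + σ * t) * infDist x A := by
  suffices h : ∃ v ∈ π.direction, v ≠ 0 ∧ ∃ σ : ℝ, 0 ≤ σ ∧ σ ≤ 1 ∧ ∀ t : ℝ, 0 ≤ 1 + σ * t →
      ∀ y ∈ A, ∃ z ∈ A, x + t • v - z = (1 + σ * t) • (x - y) by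
    obtain ⟨v, hv, hv0, σ, h0, h1, h⟩ := h
    refine ⟨v, hv, hv0, σ, h0, h1, fun t ht => ?_⟩
    have hclosed : IsClosed (A : Set G) := A.closed_of_finiteDimensional
    obtain ⟨y, hy, hxy⟩ := hclosed.exists_infDist_eq_dist hA x
    obtain ⟨z, hz, hyz⟩ := h t ht y hy
    calc infDist (x + t • v) A ≤ dist (x + t • v) z := infDist_le_dist_of_mem hz
      _ = (1 + σ * t) * infDist x A := by
        rw [hxy, dist_eq_norm, hyz, norm_smul, Real.norm_of_nonneg ht, dist_eq_norm]
  -- Transversal case: a homothety centred at a common point scales distances, `σ = 1`. Otherwise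
  -- translate along a common direction, `σ = 0`.
  by_cases hint : A.direction ⊓ π.direction = ⊥
  · have hsup : A.direction ⊔ π.direction = ⊤ := by
      apply Submodule.eq_top_of_finrank_eq
      have h1 := Submodule.finrank_sup_add_finrank_inf_eq A.direction π.direction
      rw [hint, finrank_bot] at h1
      have h2 := Submodule.finrank_le (A.direction ⊔ π.direction)
      omega
    obtain ⟨a, haA, haπ⟩ := AffineSubspace.inter_nonempty_of_nonempty_of_sup_direction_eq_top
      hA ⟨x, hx⟩ hsup
    refine ⟨x - a, AffineSubspace.vsub_mem_direction hx haπ, ?_, 1, zero_le_one, le_rfl,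
      fun t ht y hy => ⟨AffineMap.lineMap a y (1 + t), AffineMap.lineMap_mem _ haA hy, ?_⟩⟩
    · rintro h
      exact hxA (sub_eq_zero.1 h ▸ haA)
    · rw [AffineMap.lineMap_apply, vsub_eq_sub, vadd_eq_add]
      module
  · obtain ⟨v, hv, hv0⟩ := Submodule.exists_mem_ne_zero_of_ne_bot hint
    refine ⟨v, hv.2, hv0, 0, le_rfl, zero_le_one,
      fun t ht y hy => ⟨t • v +ᵥ y,
        AffineSubspace.vadd_mem_of_mem_direction (A.direction.smul_mem t hv.1) hy, ?_⟩⟩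
    rw [vadd_eq_add]
    module

/-- The complement of an affine subspace of codimension at most `q + 1` is a real `q`-convex
set. -/
lemma AffineSubspace.isRealQConvexSet_compl [FiniteDimensional ℝ G] {q : ℕ}
    {A : AffineSubspace ℝ G} (hA : (A : Set G).Nonempty) (hint : interior (A : Set G) = ∅)
    (hfin : Module.finrank ℝ G ≤ Module.finrank ℝ A.direction + (q + 1)) :
    IsRealQConvexSet q (A : Set G)ᶜ := by
  have hclosed : IsClosed (A : Set G) := A.closed_of_finiteDimensional
  rw [isRealQConvexSet_compl_iff hclosed hA hint]
  rintro π hπ p r hr hb l hl x ⟨hxb, hxπ⟩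
  have hxA := hb hxb
  by_cases hxs : x ∈ sphere p r
  · exact hl x ⟨hxs, hxπ⟩
  have hxball : x ∈ ball p r := lt_of_le_of_ne hxb hxs
  obtain ⟨v, hvπ, hv0, σ, hσ0, hσ1, hσ⟩ :=
    AffineSubspace.exists_direction_infDist_le hA (hπ ▸ hfin) hxπ hxA
  obtain ⟨t, ht, hts⟩ := exists_pos_add_smul_mem_sphere hxball hv0
  obtain ⟨s, hs, hss⟩ := exists_pos_add_smul_mem_sphere hxball (neg_ne_zero.2 hv0)
  rw [smul_neg, ← neg_smul] at hss
  have hd : ∀ y ∈ closedBall p r, 0 < infDist y (A : Set G) :=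
    fun y hy => (hclosed.notMem_iff_infDist_pos hA).1 (hb hy)
  -- Otherwise the chord would contain `x - σ⁻¹ • v`, at distance zero from `A`.
  have hpos : 0 < 1 + σ * -s := by
    by_contra! hneg
    have hσpos : 0 < σ := by
      rcases hσ0.eq_or_lt with h | h
      · rw [← h] at hneg; linarith
      · exact h
    have hmem : x + (-σ⁻¹) • v ∈ closedBall p r := by
      have hseg : x + (-σ⁻¹) • v = (1 - σ⁻¹ / s) • x + (σ⁻¹ / s) • (x + (-s) • v) := by
        match_scalars <;> field_simp; ring
      have h1 : σ⁻¹ / s ≤ 1 := by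
        rw [div_le_one hs, inv_le_iff_one_le_mul₀ hσpos]; linarith
      rw [hseg]
      exact convex_closedBall p r hxb (sphere_subset_closedBall hss) (by linarith)
        (by positivity) (by ring)
    have h1 := hσ (-σ⁻¹) (by rw [mul_neg, mul_inv_cancel₀ hσpos.ne']; simp)
    rw [mul_neg, mul_inv_cancel₀ hσpos.ne'] at h1
    have := hd _ hmem
    linarith
  have hbound : ∀ u : ℝ, 0 < 1 + σ * u → x + u • v ∈ sphere p r →
      -(σ * u) - Real.log (infDist x A) ≤ l x + u * l.linear v := by
    intro u hu hus
    have hm : x + u • v ∈ π := by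
      rw [add_comm]
      exact AffineSubspace.vadd_mem_of_mem_direction (π.direction.smul_mem u hvπ) hxπ
    have h1 := hl _ ⟨hus, hm⟩
    have h2 : l (x + u • v) = l x + u * l.linear v := by
      have := l.map_vadd x (u • v)
      rw [vadd_eq_add, vadd_eq_add, map_smul, smul_eq_mul] at this
      rw [add_comm x, this, add_comm]
    have h3 := Real.log_le_log (hd _ (sphere_subset_closedBall hus)) (hσ u hu.le)
    rw [Real.log_mul hu.ne' (hd x hxb).ne'] at h3
    have h4 := Real.log_le_sub_one_of_pos hu
    linarith
  have h1 := hbound t (by positivity) hts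
  have h2 := hbound (-s) hpos hss
  -- With weights `s` and `t` the terms in `σ` and in `l.linear v` cancel.
  have h3 := mul_le_mul_of_nonneg_left h1 hs.le
  have h4 := mul_le_mul_of_nonneg_left h2 ht.le
  have h5 : 0 ≤ (s + t) * (l x + Real.log (infDist x A)) := by linarith
  have h6 := nonneg_of_mul_nonneg_right h5 (by positivity)
  linarith

end AffineSubspaceComplement

/-! ### Midpoint identity for graphs with real `q`-convex complement. -/

section Graph

variable {E F G : Type*} [NormedAddCommGroup E] [InnerProductSpace ℝ E]
  [NormedAddCommGroup F] [InnerProductSpace ℝ F]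
  [NormedAddCommGroup G] [InnerProductSpace ℝ G]

/-- The affine chart `(s, y) ↦ (a + s • d, b + s • c + y)` of the affine span of a line in `E` and
of `F`, with values in `G ≃ E × F`. -/
def lineProdChart (e : G ≃L[ℝ] E × F) (a d : E) (b c : F) (p : ℝ × F) : G :=
  e.symm (a + p.1 • d, b + p.1 • c + p.2)

/-- The linear part of `lineProdChart`. -/
def lineProdChartLinear (e : G ≃L[ℝ] E × F) (d : E) (c : F) : ℝ × F →ₗ[ℝ] G :=
  e.symm.toLinearMap ∘ₗ
    ((LinearMap.toSpanSingleton ℝ E d ∘ₗ LinearMap.fst ℝ ℝ F).prod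
      (LinearMap.toSpanSingleton ℝ F c ∘ₗ LinearMap.fst ℝ ℝ F + LinearMap.snd ℝ ℝ F))

lemma lineProdChartLinear_apply (e : G ≃L[ℝ] E × F) (d : E) (c : F) (p : ℝ × F) :
    lineProdChartLinear e d c p = e.symm (p.1 • d, p.1 • c + p.2) := rfl

lemma lineProdChartLinear_injective (e : G ≃L[ℝ] E × F) {d : E} (hd : d ≠ 0) (c : F) :
    Function.Injective (lineProdChartLinear e d c) := by
  rw [injective_iff_map_eq_zero]
  rintro ⟨s, y⟩ h
  rw [lineProdChartLinear_apply, map_eq_zero_iff _ e.symm.injective, Prod.mk_eq_zero,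
    smul_eq_zero_iff_left hd] at h
  obtain ⟨h1, h2⟩ := h
  dsimp only at h1 h2
  rw [h1, zero_smul, zero_add] at h2
  rw [h1, h2, Prod.mk_zero_zero]

lemma lineProdChart_add (e : G ≃L[ℝ] E × F) (a d : E) (b c : F) (p p' : ℝ × F) :
    lineProdChart e a d b c (p + p') =
      lineProdChartLinear e d c p + lineProdChart e a d b c p' := by
  rw [lineProdChartLinear_apply, lineProdChart, lineProdChart, ← map_add]
  congr 1
  ext
  · simp only [Prod.fst_add, Prod.mk_add_mk]; module
  · simp only [Prod.fst_add, Prod.snd_add, Prod.mk_add_mk]; module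

lemma continuous_lineProdChart (e : G ≃L[ℝ] E × F) (a d : E) (b c : F) :
    Continuous (lineProdChart e a d b c) := by
  unfold lineProdChart
  fun_prop

/-- The image under `lineProdChart` of the hyperplane `⟪w, y⟫ = m`. -/
lemma exists_affineSubspace_lineProdChart [FiniteDimensional ℝ F] (e : G ≃L[ℝ] E × F) (a : E)
    {d : E} (hd : d ≠ 0) (b c : F) {w : F} (hw : w ≠ 0) (m : ℝ) :
    ∃ π : AffineSubspace ℝ G, Module.finrank ℝ π.direction = Module.finrank ℝ F ∧
      (π : Set G) = lineProdChart e a d b c '' {p | inner ℝ w p.2 = m} := by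
  have hw' : inner ℝ w w ≠ 0 := inner_self_ne_zero.2 hw
  let φ : Module.Dual ℝ (ℝ × F) := (innerSL ℝ w).toLinearMap ∘ₗ LinearMap.snd ℝ ℝ F
  have hφ : ∀ p, φ p = inner ℝ w p.2 := fun _ => rfl
  have hφ0 : φ ≠ 0 := fun h => hw' (by rw [← hφ (0, w), h, LinearMap.zero_apply])
  let p₀ : ℝ × F := (0, (m / inner ℝ w w) • w)
  have hp₀ : inner ℝ w p₀.2 = m := by
    simp only [p₀, inner_smul_right]
    field_simp
  refine ⟨AffineSubspace.mk' (lineProdChart e a d b c p₀) ((LinearMap.ker φ).map (lineProdChartLinear e d c)),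
    ?_, ?_⟩
  · rw [AffineSubspace.direction_mk',
      ← (Submodule.equivMapOfInjective _ (lineProdChartLinear_injective e hd c) _).finrank_eq]
    have := Module.Dual.finrank_ker_add_one_of_ne_zero hφ0
    rw [Module.finrank_prod, Module.finrank_self] at this
    omega
  · ext z
    rw [SetLike.mem_coe, AffineSubspace.mem_mk', Submodule.mem_map]
    constructor
    · rintro ⟨p, hp, hz⟩
      refine ⟨p + p₀, ?_, ?_⟩
      · rw [LinearMap.mem_ker, hφ] at hp
        rw [mem_ofPred_eq, Prod.snd_add, inner_add_right, hp, hp₀, zero_add]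
      · rw [lineProdChart_add, hz, vsub_eq_sub, sub_add_cancel]
    · rintro ⟨p, hp, rfl⟩
      refine ⟨p - p₀, ?_, ?_⟩
      · rw [mem_ofPred_eq] at hp
        rw [LinearMap.mem_ker, hφ, Prod.snd_sub, inner_sub_right, hp₀, hp, sub_self]
      · rw [vsub_eq_sub, eq_sub_iff_add_eq, ← lineProdChart_add, sub_add_cancel]

/-- A graph whose complement is real `q`-convex, with `q + 1` the codimension, satisfies the
midpoint identity. -/
lemma map_midpoint_of_isRealQConvexSet_compl_graph [FiniteDimensional ℝ F] {q : ℕ}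
    (hq : Module.finrank ℝ F = q + 1) (e : G ≃L[ℝ] E × F) {f : E → F} (hf : Continuous f)
    {Γ : Set G} (hΓ : ∀ z, z ∈ Γ ↔ (e z).2 = f (e z).1) (hint : interior Γ = ∅)
    (h : IsRealQConvexSet q Γᶜ) (x₀ x₁ : E) :
    f (midpoint ℝ x₀ x₁) = midpoint ℝ (f x₀) (f x₁) := by
  have hclosed : IsClosed Γ := by
    have : Γ = {z | (e z).2 = f (e z).1} := Set.ext hΓ
    rw [this]
    exact isClosed_eq (by fun_prop) (by fun_prop)
  have hne : Γ.Nonempty := ⟨e.symm (x₀, f x₀), by simp [hΓ]⟩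
  rw [isRealQConvexSet_compl_iff hclosed hne hint] at h
  by_contra hmid
  let d : E := x₁ - x₀
  let c : F := f x₁ - f x₀
  let w : F := f (midpoint ℝ x₀ x₁) - midpoint ℝ (f x₀) (f x₁)
  let g : ℝ → F := fun s => f (x₀ + s • d) - (f x₀ + s • c)
  have hw : w ≠ 0 := sub_ne_zero.2 hmid
  have hd : d ≠ 0 := by
    intro h0
    have : x₁ = x₀ := sub_eq_zero.1 h0
    exact hmid (by rw [this, midpoint_self, midpoint_self])
  have hg : Continuous g := by fun_prop
  have hg0 : g 0 = 0 := by simp [g]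
  have hg1 : g 1 = 0 := by simp [g, d, c]
  have hgw : g 2⁻¹ = w := by
    simp only [g, w, d, c, midpoint_eq_smul_add, invOf_eq_inv]
    congr 2 <;> module
  obtain ⟨s₀, hs₀, hmax⟩ := isCompact_Icc.exists_isMaxOn (nonempty_Icc.2 (zero_le_one' ℝ))
    (f := fun s => inner ℝ w (g s)) (by fun_prop)
  have hM : ∀ s ∈ Icc (0 : ℝ) 1, inner ℝ w (g s) ≤ inner ℝ w (g s₀) := fun s hs => hmax hs
  obtain ⟨M, hMdef⟩ : ∃ M, M = inner ℝ w (g s₀) := ⟨_, rfl⟩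
  rw [← hMdef] at hM
  have hMpos : 0 < M := by
    have h1 := hM 2⁻¹ ⟨by norm_num, by norm_num⟩
    rw [hgw] at h1
    exact (real_inner_self_pos.2 hw).trans_le h1
  obtain ⟨C, hC⟩ := (isCompact_Icc.image hg).isBounded.exists_norm_le
    (s := g '' Icc (0 : ℝ) 1)
  replace hC : ∀ s ∈ Icc (0 : ℝ) 1, ‖g s‖ ≤ C := fun s hs => hC _ (mem_image_of_mem g hs)
  -- The extra 1 keeps the graph off the side of the box and leaves room to push off it along `w`.
  let R : ℝ := C + 1
  let Φ : ℝ × F → G := lineProdChart e x₀ d (f x₀) c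
  have hΦ : Continuous Φ := continuous_lineProdChart _ _ _ _ _
  have hΦΓ : ∀ p, Φ p ∈ Γ ↔ p.2 = g p.1 := by
    intro p
    rw [hΓ]
    simp only [Φ, lineProdChart, e.apply_symm_apply, g]
    rw [eq_sub_iff_add_eq, add_comm]
  have hbox : IsCompact (Icc (0 : ℝ) 1 ×ˢ closedBall (0 : F) R) :=
    isCompact_Icc.prod (isCompact_closedBall _ _)
  let B : Set (ℝ × F) := (Icc (0 : ℝ) 1 ×ˢ closedBall (0 : F) R) ∩
    ({p | M ≤ inner ℝ w p.2} ∩ ({p | p.1 = 0} ∪ ({p | p.1 = 1} ∪ {p | ‖p.2‖ = R})))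
  have hB : IsCompact B := by
    refine hbox.inter_right ((isClosed_le ?_ ?_).inter ((isClosed_eq ?_ ?_).union
      ((isClosed_eq ?_ ?_).union (isClosed_eq ?_ ?_)))) <;> fun_prop
  -- The graph misses `B`: over the ends `g` vanishes while `M > 0`, and on the side `‖g‖ ≤ C < R`.
  -- This `δ` serves every `m > M`.
  obtain ⟨δ, hδ, hBδ⟩ : ∃ δ, 0 < δ ∧ ∀ p ∈ B, δ ≤ infDist (Φ p) Γ := by
    refine hB.exists_forall_le' ((continuous_infDist_pt Γ).comp hΦ).continuousOn ?_
    rintro ⟨s, y⟩ ⟨⟨hs, -⟩, hy, hbd⟩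
    refine (hclosed.notMem_iff_infDist_pos hne).1 fun hmem => ?_
    rw [hΦΓ] at hmem
    dsimp only at hmem hs
    rw [mem_ofPred_eq] at hy
    rcases hbd with rfl | rfl | hR
    · rw [hmem, hg0, inner_zero_right] at hy; linarith
    · rw [hmem, hg1, inner_zero_right] at hy; linarith
    · rw [mem_ofPred_eq] at hR
      have := hC s hs
      rw [← hmem, hR] at this
      simp only [R] at this
      linarith
  have hstep : ∀ m, M < m → ∀ p ∈ (Icc (0 : ℝ) 1 ×ˢ closedBall (0 : F) R),
      inner ℝ w p.2 = m → δ ≤ infDist (Φ p) Γ := by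
    intro m hm p hp hpm
    obtain ⟨π, hπ, hπΦ⟩ := exists_affineSubspace_lineProdChart e x₀ hd (f x₀) c hw m
    let K : Set G := Φ '' ((Icc (0 : ℝ) 1 ×ˢ closedBall (0 : F) R) ∩ {p | inner ℝ w p.2 = m})
    have hK : IsCompact K :=
      (hbox.inter_right (isClosed_eq (by fun_prop) (by fun_prop))).image hΦ
    have hKΓ : K ⊆ Γᶜ := by
      rintro _ ⟨p, ⟨⟨hp1, -⟩, hp2⟩, rfl⟩ hmem
      rw [hΦΓ] at hmem
      have h1 := hM p.1 hp1
      rw [← hmem, hp2] at h1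
      linarith
    have hKπ : K ⊆ π := by
      rw [hπΦ]
      exact image_mono inter_subset_right
    -- `S` and `Y` invert the chart on its image but are continuous on all of `G`, so `V` is open in
    -- `G`.
    let S : G → ℝ := fun z => inner ℝ d ((e z).1 - x₀) / inner ℝ d d
    let Y : G → F := fun z => (e z).2 - f x₀ - S z • c
    have hdd : inner ℝ d d ≠ 0 := inner_self_ne_zero.2 hd
    have hS : Continuous S := by fun_prop
    have hY : Continuous Y := by fun_prop
    have hSΦ : ∀ p, S (Φ p) = p.1 := by
      intro p
      simp only [S, Φ, lineProdChart, e.apply_symm_apply, add_sub_cancel_left, inner_smul_right]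
      field_simp
    have hYΦ : ∀ p, Y (Φ p) = p.2 := by
      intro p
      simp only [Y, hSΦ]
      simp only [Φ, lineProdChart, e.apply_symm_apply]
      abel
    let V : Set G := S ⁻¹' Ioo 0 1 ∩ Y ⁻¹' ball 0 R
    have hV : IsOpen V := (isOpen_Ioo.preimage hS).inter (isOpen_ball.preimage hY)
    have hVK : V ∩ π ⊆ K := by
      rw [hπΦ]
      rintro _ ⟨⟨h1, h2⟩, p, hp, rfl⟩
      rw [mem_preimage, hSΦ] at h1
      rw [mem_preimage, hYΦ] at h2
      exact ⟨p, ⟨⟨Ioo_subset_Icc_self h1, ball_subset_closedBall h2⟩, hp⟩, rfl⟩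
    have hpos : ∀ z ∈ Γᶜ, 0 < infDist z Γ :=
      fun z hz => (hclosed.notMem_iff_infDist_pos hne).1 hz
    have hcont : ContinuousOn (fun z => -Real.log (infDist z Γ)) Γᶜ :=
      ((continuous_infDist_pt Γ).continuousOn.log fun z hz => (hpos z hz).ne').neg
    have hbd : ∀ z ∈ K \ V, -Real.log (infDist z Γ) ≤ -Real.log δ := by
      rintro _ ⟨⟨p, ⟨⟨hp1, hp2⟩, hp3⟩, rfl⟩, hpV⟩
      refine neg_le_neg (Real.log_le_log hδ (hBδ p ⟨⟨hp1, hp2⟩, ?_, ?_⟩))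
      · exact hm.le.trans_eq hp3.symm
      · by_contra hcon
        simp only [mem_union, mem_ofPred_eq, not_or] at hcon
        refine hpV ⟨?_, ?_⟩
        · rw [mem_preimage, hSΦ]
          exact ⟨lt_of_le_of_ne hp1.1 (Ne.symm hcon.1), lt_of_le_of_ne hp1.2 hcon.2.1⟩
        · rw [mem_preimage, hYΦ, mem_ball_zero_iff]
          exact lt_of_le_of_ne (mem_closedBall_zero_iff.1 hp2) hcon.2.2
    have hpK : Φ p ∈ K := ⟨p, ⟨hp, hpm⟩, rfl⟩
    have := le_of_forall_le_of_affine_max_property hclosed.isOpen_compl hcont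
      (h π (hπ.trans hq)) hK hKΓ hKπ hV hVK hbd (Φ p) hpK
    exact (Real.log_le_log_iff hδ (hpos _ (hKΓ hpK))).1 (neg_le_neg_iff.1 this)
  -- `Φ (s₀, g s₀)` is the touching point on the graph; adding `t • w` lifts it to the slice `m = M
  -- + t * ⟪w, w⟫`.
  have hlim : Tendsto (fun t : ℝ => infDist (Φ (s₀, g s₀ + t • w)) Γ) (𝓝[>] 0) (𝓝 0) := by
    have h1 : Continuous fun t : ℝ => infDist (Φ (s₀, g s₀ + t • w)) Γ :=
      (continuous_infDist_pt Γ).comp (hΦ.comp (by fun_prop))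
    have h2 := h1.tendsto 0
    rw [zero_smul, add_zero, infDist_zero_of_mem ((hΦΓ _).2 rfl)] at h2
    exact h2.mono_left nhdsWithin_le_nhds
  have hev : ∀ᶠ t : ℝ in 𝓝[>] 0, δ ≤ infDist (Φ (s₀, g s₀ + t • w)) Γ := by
    have hsmall : ∀ᶠ t : ℝ in 𝓝[>] 0, ‖t • w‖ < 1 := by
      have h1 : Continuous fun t : ℝ => ‖t • w‖ := by fun_prop
      have h2 := h1.tendsto 0
      rw [zero_smul, norm_zero] at h2
      exact (h2.mono_left nhdsWithin_le_nhds).eventually_lt_const one_pos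
    filter_upwards [hsmall, self_mem_nhdsWithin] with t ht htpos
    refine hstep (M + t * inner ℝ w w) ?_ _ ⟨hs₀, ?_⟩ ?_
    · have := mul_pos (mem_Ioi.1 htpos) (real_inner_self_pos.2 hw)
      linarith
    · rw [mem_closedBall_zero_iff]
      exact (norm_add_le _ _).trans (add_le_add (hC s₀ hs₀) ht.le)
    · rw [inner_add_right, inner_smul_right, hMdef]
  exact absurd (ge_of_tendsto hlim hev) (not_le.2 hδ)

end Graph

/-! ### Graphs in Euclidean coordinates. -/

section EuclideanGraph

variable {n k : ℕ}

lemma finAddEquivProd_symm_apply (x : EuclideanSpace ℝ (Fin n)) (y : EuclideanSpace ℝ (Fin k)) :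
    (EuclideanSpace.finAddEquivProd (𝕜 := ℝ)).symm (x, y) =
      WithLp.toLp 2 (Fin.append (⇑x) (⇑y)) := by
  rw [ContinuousLinearEquiv.symm_apply_eq]
  ext i
  · simp
  · simp

lemma mem_euclideanGraph_iff {f : EuclideanSpace ℝ (Fin n) → EuclideanSpace ℝ (Fin k)}
    {z : EuclideanSpace ℝ (Fin (n + k))} :
    z ∈ euclideanGraph f ↔
      (EuclideanSpace.finAddEquivProd (𝕜 := ℝ) z).2 =
        f (EuclideanSpace.finAddEquivProd (𝕜 := ℝ) z).1 := by
  constructor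
  · rintro ⟨x, rfl⟩
    rw [← finAddEquivProd_symm_apply, ContinuousLinearEquiv.apply_symm_apply]
  · intro h
    refine ⟨(EuclideanSpace.finAddEquivProd (𝕜 := ℝ) z).1, ?_⟩
    rw [← finAddEquivProd_symm_apply, ← h, Prod.mk.eta, ContinuousLinearEquiv.symm_apply_apply]

/-- A nonzero vertical displacement, available since `k ≥ 1`, always leaves the graph. -/
lemma interior_euclideanGraph (hk : 1 ≤ k)
    (f : EuclideanSpace ℝ (Fin n) → EuclideanSpace ℝ (Fin k)) :
    interior (euclideanGraph f) = ∅ := by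
  have : Nonempty (Fin k) := ⟨⟨0, hk⟩⟩
  obtain ⟨y, hy⟩ := exists_ne (0 : EuclideanSpace ℝ (Fin k))
  refine eq_empty_of_forall_notMem fun z hz => ?_
  let e : EuclideanSpace ℝ (Fin (n + k)) ≃L[ℝ] _ × _ := EuclideanSpace.finAddEquivProd
  have hcont : Continuous fun t : ℝ => z + t • e.symm (0, y) := by fun_prop
  have hlim := hcont.tendsto 0
  rw [zero_smul, add_zero] at hlim
  have hev : ∀ᶠ t : ℝ in 𝓝[≠] 0, z + t • e.symm (0, y) ∈ euclideanGraph f :=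
    (hlim.eventually (mem_interior_iff_mem_nhds.1 hz)).filter_mono nhdsWithin_le_nhds
  obtain ⟨t, ht, ht0⟩ := (hev.and self_mem_nhdsWithin).exists
  have h0 := mem_euclideanGraph_iff.1 (interior_subset hz)
  have h1 : (e (z + t • e.symm (0, y))).2 = f (e (z + t • e.symm (0, y))).1 :=
    mem_euclideanGraph_iff.1 ht
  rw [map_add, map_smul, e.apply_symm_apply, Prod.fst_add, Prod.snd_add, Prod.smul_fst,
    Prod.smul_snd, smul_zero, add_zero, ← h0, add_eq_left, smul_eq_zero] at h1
  exact h1.elim ht0 hy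

/-- The graph of an affine map is an affine subspace of dimension `n`. -/
lemma exists_affineSubspace_coe_eq_euclideanGraph
    (g : EuclideanSpace ℝ (Fin n) →ᵃ[ℝ] EuclideanSpace ℝ (Fin k)) :
    ∃ A : AffineSubspace ℝ (EuclideanSpace ℝ (Fin (n + k))),
      (A : Set (EuclideanSpace ℝ (Fin (n + k)))) = euclideanGraph g ∧
      Module.finrank ℝ A.direction = n := by
  let e : EuclideanSpace ℝ (Fin (n + k)) ≃L[ℝ] _ × _ := EuclideanSpace.finAddEquivProd
  let Ψ : EuclideanSpace ℝ (Fin n) →ᵃ[ℝ] EuclideanSpace ℝ (Fin (n + k)) :=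
    e.symm.toLinearMap.toAffineMap.comp ((AffineMap.id ℝ _).prod g)
  have hΨ : ∀ x, Ψ x = WithLp.toLp 2 (Fin.append (⇑x) (⇑(g x))) :=
    fun x => finAddEquivProd_symm_apply x (g x)
  have hinj : Function.Injective Ψ := fun x y hxy =>
    congrArg Prod.fst (e.symm.injective hxy : (x, g x) = (y, g y))
  refine ⟨(⊤ : AffineSubspace ℝ _).map Ψ, ?_, ?_⟩
  · ext z
    rw [AffineSubspace.coe_map, AffineSubspace.top_coe, image_univ]
    simp only [mem_range, hΨ, euclideanGraph, mem_ofPred_eq, eq_comm]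
  · rw [AffineSubspace.map_direction, AffineSubspace.direction_top,
      ← (Submodule.equivMapOfInjective _ (Ψ.linear_injective_iff.2 hinj) _).finrank_eq,
      finrank_top, finrank_euclideanSpace_fin]

end EuclideanGraph

theorem mainTheorem4 (n k : ℕ) (hk : 1 ≤ k)
    (f : EuclideanSpace ℝ (Fin n) → EuclideanSpace ℝ (Fin k)) (hf : Continuous f) :
    (∃ g : EuclideanSpace ℝ (Fin n) →ᵃ[ℝ] EuclideanSpace ℝ (Fin k), ∀ x, f x = g x) ↔
      IsRealQConvexSet (k - 1) (euclideanGraph f)ᶜ := by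
  have hint := interior_euclideanGraph hk f
  constructor
  · rintro ⟨g, hg⟩
    obtain rfl : f = g := funext hg
    obtain ⟨A, hA, hfin⟩ := exists_affineSubspace_coe_eq_euclideanGraph g
    rw [← hA] at hint ⊢
    refine A.isRealQConvexSet_compl (hA ▸ ⟨_, 0, rfl⟩) hint ?_
    rw [finrank_euclideanSpace_fin, hfin, Nat.sub_add_cancel hk]
  · intro h
    have hq : Module.finrank ℝ (EuclideanSpace ℝ (Fin k)) = k - 1 + 1 := by
      rw [finrank_euclideanSpace_fin, Nat.sub_add_cancel hk]
    exact ⟨AffineMap.ofMapMidpoint f (map_midpoint_of_isRealQConvexSet_compl_graph hq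
      EuclideanSpace.finAddEquivProd hf (fun _ => mem_euclideanGraph_iff) hint h) hf,
      fun _ => rfl⟩
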